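/- Let $\Omega\subset\mathbb{R}^2$ be a bounded open set (for instance an open polygon), and let all function spaces be complex. Let $H^1_0(\Omega)$ be the closure of $C_c^\infty(\Omega)$ in $H^1(\Omega)$, and let $H(\operatorname{div},\Omega)$ be the space of all $\underline{s}\in L^2(\Omega)^2$ whose distributional divergence belongs to $L^2(\Omega)$. Consider in $L^2(\Omega)^3=L^2(\Omega)\oplus L^2(\Omega)^2$ the grad-div operator $$\mathcal{G}\begin{bmatrix}u\\ \underline{s}\end{bmatrix}=\begin{bmatrix} i\operatorname{div}\underline{s}\\ i\operatorname{grad}u\end{bmatrix},\qquad \operatorname{D}(\mathcal{G})=H^1_0(\Omega)\times H(\operatorname{div},\Omega),$$ and in $L^2(\Omega)$ the Dirichlet Laplacian $-\Delta u=-\operatorname{div}(\operatorname{grad}u)$ with domain $\operatorname{D}(\Delta)=\{u\in H^1_0(\Omega):\operatorname{grad}u\in H(\operatorname{div},\Omega)\}$. Eigenfunctions are non-zero by definition. **Lemma.** A vector $\begin{bmatrix}u\\ \underline{s}\end{bmatrix}\in\operatorname{D}(\mathcal{G})$ is an eigenfunction of $\mathcal{G}$ (for some eigenvalue in $\mathbb{C}$)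 if and only if one of the following holds: 1. $0\neq u\in\operatorname{D}(\Delta)$ and there is a real $\omega\neq0$ such that $-\Delta u=\omega^2u$ and $\underline{s}=\frac{i}{|\omega|}\operatorname{grad}u$ or $\underline{s}=-\frac{i}{|\omega|}\operatorname{grad}u$; 2. $u=0$, $\underline{s}\neq0$ and $\operatorname{div}\underline{s}=0$. Moreover, in case 1 the eigenvalue associated to $\begin{bmatrix}u\\ \underline{s}\end{bmatrix}$ is $|\omega|$ if $\underline{s}=\frac{i}{|\omega|}\operatorname{grad}u$ and $-|\omega|$ if $\underline{s}=-\frac{i}{|\omega|}\operatorname{grad}u$; in case 2 it is $0$. -/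

import Mathlib

open MeasureTheory TopologicalSpace
open scoped Distributions

/-- The Euclidean plane. -/
abbrev Plane : Type := EuclideanSpace ℝ (Fin 2)

/-- The complex Hilbert space `L²(Ω)`. -/
abbrev L2 (Ω : Opens Plane) : Type := Lp ℂ 2 (volume.restrict (Ω : Set Plane))

/-- The complex Hilbert space `L²(Ω)²` of square integrable vector fields. -/
abbrev L2Vec (Ω : Opens Plane) : Type :=
  Lp (EuclideanSpace ℂ (Fin 2)) 2 (volume.restrict (Ω : Set Plane))

/-- The Hilbert space `L²(Ω)³ = L²(Ω) ⊕ L²(Ω)²`. -/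
abbrev L2Triple (Ω : Opens Plane) : Type := WithLp 2 (L2 Ω × L2Vec Ω)

/-- The classical partial derivative `∂ᵢ φ`. -/
noncomputable def partialDeriv (i : Fin 2) (φ : Plane → ℂ) (x : Plane) : ℂ :=
  fderiv ℝ φ x (EuclideanSpace.single i 1)

/-- The classical gradient of a function. -/
noncomputable def classicalGrad (φ : Plane → ℂ) (x : Plane) : EuclideanSpace ℂ (Fin 2) :=
  WithLp.toLp 2 fun i => partialDeriv i φ x

/-- `g` is the weak (distributional) gradient of `u` on `Ω`. -/
def IsWeakGrad (Ω : Opens Plane) (u : L2 Ω) (g : L2Vec Ω) : Prop :=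
  ∀ (φ : 𝓓(Ω, ℂ)) (i : Fin 2),
    ∫ x in (Ω : Set Plane), u x * partialDeriv i φ x = -∫ x in (Ω : Set Plane), g x i * φ x

/-- `d` is the weak (distributional) divergence of the vector field `s` on `Ω`. -/
def IsWeakDiv (Ω : Opens Plane) (s : L2Vec Ω) (d : L2 Ω) : Prop :=
  ∀ φ : 𝓓(Ω, ℂ),
    ∫ x in (Ω : Set Plane), ∑ i, s x i * partialDeriv i φ x
      = -∫ x in (Ω : Set Plane), d x * φ x

section Helpers

variable {Ω : Opens Plane}

theorem continuous_partialDeriv (φ : 𝓓(Ω, ℂ)) (i : Fin 2) : Continuous (partialDeriv i φ) :=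
  (φ.contDiff.continuous_fderiv (by simp)).clm_apply continuous_const

theorem continuous_classicalGrad (φ : 𝓓(Ω, ℂ)) : Continuous (classicalGrad φ) :=
  (PiLp.continuous_toLp 2 _).comp (continuous_pi fun i => continuous_partialDeriv φ i)

theorem hasCompactSupport_partialDeriv (φ : 𝓓(Ω, ℂ)) (i : Fin 2) :
    HasCompactSupport (partialDeriv i φ) :=
  φ.hasCompactSupport.fderiv_apply ℝ (EuclideanSpace.single i 1)

theorem hasCompactSupport_classicalGrad (φ : 𝓓(Ω, ℂ)) : HasCompactSupport (classicalGrad φ) := by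
  refine (φ.hasCompactSupport.fderiv ℝ).mono fun x hx h => hx ?_
  ext i
  simp [classicalGrad, partialDeriv, h]

theorem memLp_test (φ : 𝓓(Ω, ℂ)) : MemLp φ 2 (volume.restrict (Ω : Set Plane)) :=
  φ.continuous.memLp_of_hasCompactSupport φ.hasCompactSupport

theorem memLp_partialDeriv (φ : 𝓓(Ω, ℂ)) (i : Fin 2) :
    MemLp (partialDeriv i φ) 2 (volume.restrict (Ω : Set Plane)) :=
  (continuous_partialDeriv φ i).memLp_of_hasCompactSupport (hasCompactSupport_partialDeriv φ i)

theorem memLp_classicalGrad (φ : 𝓓(Ω, ℂ)) :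
    MemLp (classicalGrad φ) 2 (volume.restrict (Ω : Set Plane)) :=
  (continuous_classicalGrad φ).memLp_of_hasCompactSupport (hasCompactSupport_classicalGrad φ)

theorem memLp_coord (g : L2Vec Ω) (i : Fin 2) :
    MemLp (fun x => g x i) 2 (volume.restrict (Ω : Set Plane)) :=
  (EuclideanSpace.proj (𝕜 := ℂ) i).comp_memLp' (Lp.memLp g)

theorem integrable_mul_test {f : Plane → ℂ} (hf : MemLp f 2 (volume.restrict (Ω : Set Plane)))
    (φ : 𝓓(Ω, ℂ)) : Integrable (fun x => f x * φ x) (volume.restrict (Ω : Set Plane)) :=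
  hf.integrable_mul (memLp_test φ)

theorem integrable_mul_partialDeriv {f : Plane → ℂ}
    (hf : MemLp f 2 (volume.restrict (Ω : Set Plane))) (φ : 𝓓(Ω, ℂ)) (i : Fin 2) :
    Integrable (fun x => f x * partialDeriv i φ x) (volume.restrict (Ω : Set Plane)) :=
  hf.integrable_mul (memLp_partialDeriv φ i)

theorem partialDeriv_add (φ ψ : 𝓓(Ω, ℂ)) (i : Fin 2) (x : Plane) :
    partialDeriv i (φ + ψ : 𝓓(Ω, ℂ)) x = partialDeriv i φ x + partialDeriv i ψ x := by
  have h1 := (φ.contDiff.differentiable (by simp)) x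
  have h2 := (ψ.contDiff.differentiable (by simp)) x
  simp [partialDeriv, fderiv_add h1 h2]

theorem partialDeriv_smul (c : ℂ) (φ : 𝓓(Ω, ℂ)) (i : Fin 2) (x : Plane) :
    partialDeriv i (c • φ : 𝓓(Ω, ℂ)) x = c * partialDeriv i φ x := by
  have h1 := (φ.contDiff.differentiable (by simp)) x
  simp [partialDeriv, fderiv_const_smul h1 c]

theorem ae_zero_of_test {f : Plane → ℂ} (hf : MemLp f 2 (volume.restrict (Ω : Set Plane)))
    (h : ∀ φ : 𝓓(Ω, ℂ), ∫ x in (Ω : Set Plane), f x * φ x = 0) :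
    ∀ᵐ x ∂(volume.restrict (Ω : Set Plane)), f x = 0 := by
  rw [ae_restrict_iff' Ω.isOpen.measurableSet]
  have h2 : LocallyIntegrableOn f (Ω : Set Plane) volume :=
    locallyIntegrableOn_of_locallyIntegrable_restrict (hf.locallyIntegrable (by norm_num))
  refine Ω.isOpen.ae_eq_zero_of_integral_contDiff_smul_eq_zero h2 fun g hg hc hs => ?_
  have hsupp : Function.support (fun x => (g x : ℂ)) = Function.support g := by
    ext x; simp
  let φ : 𝓓(Ω, ℂ) :=
    { toFun := fun x => (g x : ℂ)
      contDiff' := Complex.ofRealCLM.contDiff.comp hg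
      hasCompactSupport' := by
        unfold HasCompactSupport tsupport at *; rwa [hsupp]
      tsupport_subset' := by
        unfold tsupport at *; rwa [hsupp] }
  have key : ∫ x in (Ω : Set Plane), g x • f x = 0 := by
    rw [← h φ]
    refine integral_congr_ae (Filter.Eventually.of_forall fun x => ?_)
    simp only [Complex.real_smul]
    exact mul_comm _ _
  rw [← key, setIntegral_eq_integral_of_forall_compl_eq_zero]
  intro x hx
  rw [image_eq_zero_of_notMem_tsupport fun h => hx (hs h), zero_smul]

theorem IsWeakGrad.zero : IsWeakGrad Ω 0 0 := by
  intro φ i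
  have h1 := Lp.coeFn_zero ℂ 2 (volume.restrict (Ω : Set Plane))
  have h2 := Lp.coeFn_zero (EuclideanSpace ℂ (Fin 2)) 2 (volume.restrict (Ω : Set Plane))
  rw [integral_eq_zero_of_ae, integral_eq_zero_of_ae, neg_zero]
  · filter_upwards [h2] with x hx
    simp only [hx, Pi.zero_apply, PiLp.zero_apply, zero_mul]
  · filter_upwards [h1] with x hx
    simp only [hx, Pi.zero_apply, zero_mul]

theorem IsWeakGrad.add {u v : L2 Ω} {g k : L2Vec Ω} (hu : IsWeakGrad Ω u g)
    (hv : IsWeakGrad Ω v k) : IsWeakGrad Ω (u + v) (g + k) := by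
  intro φ i
  have e1 : ∫ x in (Ω : Set Plane), (u + v : L2 Ω) x * partialDeriv i φ x
      = ∫ x in (Ω : Set Plane), (u x * partialDeriv i φ x + v x * partialDeriv i φ x) := by
    refine integral_congr_ae ?_
    filter_upwards [Lp.coeFn_add u v] with x hx
    rw [hx, Pi.add_apply, add_mul]
  have e2 : ∫ x in (Ω : Set Plane), (g + k : L2Vec Ω) x i * φ x
      = ∫ x in (Ω : Set Plane), (g x i * φ x + k x i * φ x) := by
    refine integral_congr_ae ?_
    filter_upwards [Lp.coeFn_add g k] with x hx
    rw [hx, Pi.add_apply, PiLp.add_apply, add_mul]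
  rw [e1, e2, integral_add (integrable_mul_partialDeriv (Lp.memLp u) φ i)
    (integrable_mul_partialDeriv (Lp.memLp v) φ i),
    integral_add (integrable_mul_test (memLp_coord g i) φ)
    (integrable_mul_test (memLp_coord k i) φ), hu φ i, hv φ i]
  ring

theorem IsWeakGrad.smul (c : ℂ) {u : L2 Ω} {g : L2Vec Ω} (hu : IsWeakGrad Ω u g) :
    IsWeakGrad Ω (c • u) (c • g) := by
  intro φ i
  have e1 : ∫ x in (Ω : Set Plane), (c • u : L2 Ω) x * partialDeriv i φ x
      = ∫ x in (Ω : Set Plane), c * (u x * partialDeriv i φ x) := by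
    refine integral_congr_ae ?_
    filter_upwards [Lp.coeFn_smul c u] with x hx
    rw [hx, Pi.smul_apply, smul_eq_mul, mul_assoc]
  have e2 : ∫ x in (Ω : Set Plane), (c • g : L2Vec Ω) x i * φ x
      = ∫ x in (Ω : Set Plane), c * (g x i * φ x) := by
    refine integral_congr_ae ?_
    filter_upwards [Lp.coeFn_smul c g] with x hx
    rw [hx, Pi.smul_apply, PiLp.smul_apply, smul_eq_mul, mul_assoc]
  rw [e1, e2, integral_const_mul, integral_const_mul, hu φ i]
  ring

theorem IsWeakGrad.unique {u : L2 Ω} {g k : L2Vec Ω} (hg : IsWeakGrad Ω u g)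
    (hk : IsWeakGrad Ω u k) : g = k := by
  have h : ∀ i : Fin 2, ∀ᵐ x ∂(volume.restrict (Ω : Set Plane)), g x i - k x i = 0 := by
    intro i
    refine ae_zero_of_test ((memLp_coord g i).sub (memLp_coord k i)) fun φ => ?_
    have e := (hg φ i).symm.trans (hk φ i)
    simp only [sub_mul]
    rw [integral_sub (integrable_mul_test (memLp_coord g i) φ)
      (integrable_mul_test (memLp_coord k i) φ), neg_injective e, sub_self]
  refine Lp.ext ?_
  filter_upwards [h 0, h 1] with x h0 h1
  ext i
  fin_cases i
  · exact sub_eq_zero.mp h0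
  · exact sub_eq_zero.mp h1

theorem integrable_dot (s : L2Vec Ω) (φ : 𝓓(Ω, ℂ)) :
    Integrable (fun x => ∑ i, s x i * partialDeriv i φ x) (volume.restrict (Ω : Set Plane)) :=
  integrable_finsetSum _ fun i _ => integrable_mul_partialDeriv (memLp_coord s i) φ i

theorem IsWeakDiv.zero : IsWeakDiv Ω 0 0 := by
  intro φ
  have h1 := Lp.coeFn_zero ℂ 2 (volume.restrict (Ω : Set Plane))
  have h2 := Lp.coeFn_zero (EuclideanSpace ℂ (Fin 2)) 2 (volume.restrict (Ω : Set Plane))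
  rw [integral_eq_zero_of_ae, integral_eq_zero_of_ae, neg_zero]
  · filter_upwards [h1] with x hx
    simp only [hx, Pi.zero_apply, zero_mul]
  · filter_upwards [h2] with x hx
    simp only [hx, Pi.zero_apply, PiLp.zero_apply, zero_mul, Finset.sum_const_zero]

theorem IsWeakDiv.add {s t : L2Vec Ω} {d e : L2 Ω} (hs : IsWeakDiv Ω s d)
    (ht : IsWeakDiv Ω t e) : IsWeakDiv Ω (s + t) (d + e) := by
  intro φ
  have e1 : ∫ x in (Ω : Set Plane), ∑ i, (s + t : L2Vec Ω) x i * partialDeriv i φ x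
      = ∫ x in (Ω : Set Plane), ((∑ i, s x i * partialDeriv i φ x)
          + ∑ i, t x i * partialDeriv i φ x) := by
    refine integral_congr_ae ?_
    filter_upwards [Lp.coeFn_add s t] with x hx
    simp only [hx, Pi.add_apply, PiLp.add_apply, add_mul, Finset.sum_add_distrib]
  have e2 : ∫ x in (Ω : Set Plane), (d + e : L2 Ω) x * φ x
      = ∫ x in (Ω : Set Plane), (d x * φ x + e x * φ x) := by
    refine integral_congr_ae ?_
    filter_upwards [Lp.coeFn_add d e] with x hx
    rw [hx, Pi.add_apply, add_mul]
  rw [e1, e2, integral_add (integrable_dot s φ) (integrable_dot t φ),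
    integral_add (integrable_mul_test (Lp.memLp d) φ) (integrable_mul_test (Lp.memLp e) φ),
    hs φ, ht φ]
  ring

theorem IsWeakDiv.smul (c : ℂ) {s : L2Vec Ω} {d : L2 Ω} (hs : IsWeakDiv Ω s d) :
    IsWeakDiv Ω (c • s) (c • d) := by
  intro φ
  have e1 : ∫ x in (Ω : Set Plane), ∑ i, (c • s : L2Vec Ω) x i * partialDeriv i φ x
      = ∫ x in (Ω : Set Plane), c * ∑ i, s x i * partialDeriv i φ x := by
    refine integral_congr_ae ?_
    filter_upwards [Lp.coeFn_smul c s] with x hx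
    simp only [hx, Pi.smul_apply, PiLp.smul_apply, smul_eq_mul, mul_assoc, Finset.mul_sum]
  have e2 : ∫ x in (Ω : Set Plane), (c • d : L2 Ω) x * φ x
      = ∫ x in (Ω : Set Plane), c * (d x * φ x) := by
    refine integral_congr_ae ?_
    filter_upwards [Lp.coeFn_smul c d] with x hx
    rw [hx, Pi.smul_apply, smul_eq_mul, mul_assoc]
  rw [e1, e2, integral_const_mul, integral_const_mul, hs φ]
  ring

theorem IsWeakDiv.unique {s : L2Vec Ω} {d e : L2 Ω} (hd : IsWeakDiv Ω s d)
    (he : IsWeakDiv Ω s e) : d = e := by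
  have h : ∀ᵐ x ∂(volume.restrict (Ω : Set Plane)), d x - e x = 0 := by
    refine ae_zero_of_test ((Lp.memLp d).sub (Lp.memLp e)) fun φ => ?_
    have k := (hd φ).symm.trans (he φ)
    simp only [sub_mul]
    rw [integral_sub (integrable_mul_test (Lp.memLp d) φ)
      (integrable_mul_test (Lp.memLp e) φ), neg_injective k, sub_self]
  refine Lp.ext ?_
  filter_upwards [h] with x hx
  exact sub_eq_zero.mp hx

end Helpers

/-- The Sobolev space `H¹(Ω)`: functions in `L²(Ω)` with weak gradient in `L²(Ω)²`. -/
def H1 (Ω : Opens Plane) : Submodule ℂ (L2 Ω) where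
  carrier := {u | ∃ g, IsWeakGrad Ω u g}
  zero_mem' := ⟨0, IsWeakGrad.zero⟩
  add_mem' := fun ⟨g, hg⟩ ⟨k, hk⟩ => ⟨g + k, hg.add hk⟩
  smul_mem' := fun c _ ⟨g, hg⟩ => ⟨c • g, hg.smul c⟩

/-- The weak gradient `H¹(Ω) → L²(Ω)²`. -/
noncomputable def weakGrad (Ω : Opens Plane) : H1 Ω →ₗ[ℂ] L2Vec Ω where
  toFun u := u.2.choose
  map_add' u v := (u + v).2.choose_spec.unique (u.2.choose_spec.add v.2.choose_spec)
  map_smul' c u := (c • u).2.choose_spec.unique (u.2.choose_spec.smul c)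

theorem isWeakGrad_weakGrad {Ω : Opens Plane} (u : H1 Ω) : IsWeakGrad Ω u (weakGrad Ω u) :=
  u.2.choose_spec

/-- The maximal divergence domain `H(div, Ω)`: fields in `L²(Ω)²` with weak divergence in
`L²(Ω)`. -/
def Hdiv (Ω : Opens Plane) : Submodule ℂ (L2Vec Ω) where
  carrier := {s | ∃ d, IsWeakDiv Ω s d}
  zero_mem' := ⟨0, IsWeakDiv.zero⟩
  add_mem' := fun ⟨d, hd⟩ ⟨e, he⟩ => ⟨d + e, hd.add he⟩
  smul_mem' := fun c _ ⟨d, hd⟩ => ⟨c • d, hd.smul c⟩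

/-- The weak divergence `H(div, Ω) → L²(Ω)`. -/
noncomputable def weakDiv (Ω : Opens Plane) : Hdiv Ω →ₗ[ℂ] L2 Ω where
  toFun s := s.2.choose
  map_add' s t := (s + t).2.choose_spec.unique (s.2.choose_spec.add t.2.choose_spec)
  map_smul' c s := (c • s).2.choose_spec.unique (s.2.choose_spec.smul c)

theorem isWeakDiv_weakDiv {Ω : Opens Plane} (s : Hdiv Ω) : IsWeakDiv Ω s (weakDiv Ω s) :=
  s.2.choose_spec

/-- The map `φ ↦ (φ, grad φ)` from test functions on `Ω` to `L²(Ω) × L²(Ω)²`. -/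
noncomputable def testGraph (Ω : Opens Plane) : 𝓓(Ω, ℂ) →ₗ[ℂ] L2 Ω × L2Vec Ω where
  toFun φ := ((memLp_test φ).toLp φ, (memLp_classicalGrad φ).toLp (classicalGrad φ))
  map_add' φ ψ := by
    refine Prod.ext (MemLp.toLp_add (memLp_test φ) (memLp_test ψ)) ?_
    refine Eq.trans ?_ (MemLp.toLp_add (memLp_classicalGrad φ) (memLp_classicalGrad ψ))
    refine MemLp.toLp_congr (memLp_classicalGrad _) _ (Filter.Eventually.of_forall fun x => ?_)
    ext i
    simp only [classicalGrad, partialDeriv_add, Pi.add_apply, PiLp.add_apply]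
  map_smul' c φ := by
    refine Prod.ext (MemLp.toLp_const_smul c (memLp_test φ)) ?_
    refine Eq.trans ?_ (MemLp.toLp_const_smul c (memLp_classicalGrad φ))
    refine MemLp.toLp_congr (memLp_classicalGrad _) _ (Filter.Eventually.of_forall fun x => ?_)
    ext i
    simp only [classicalGrad, partialDeriv_smul, Pi.smul_apply, PiLp.smul_apply, smul_eq_mul]

/-- The Sobolev space `H¹₀(Ω)`: the closure of `C_c^∞(Ω)` in `H¹(Ω)`. Convergence in `H¹(Ω)` is
convergence of both the function and its weak gradient in `L²`. -/
noncomputable def H10 (Ω : Opens Plane) : Submodule ℂ (L2 Ω) where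
  carrier := {u | ∃ g, IsWeakGrad Ω u g ∧
    (u, g) ∈ (LinearMap.range (testGraph Ω)).topologicalClosure}
  zero_mem' := ⟨0, IsWeakGrad.zero, Submodule.zero_mem _⟩
  add_mem' := fun ⟨g, hg, hg'⟩ ⟨k, hk, hk'⟩ => ⟨g + k, hg.add hk, Submodule.add_mem _ hg' hk'⟩
  smul_mem' := fun c _ ⟨g, hg, hg'⟩ => ⟨c • g, hg.smul c, Submodule.smul_mem _ c hg'⟩

theorem H10_le_H1 (Ω : Opens Plane) : H10 Ω ≤ H1 Ω := fun _ ⟨g, hg, _⟩ => ⟨g, hg⟩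

/-- The minimal gradient `grad : H¹₀(Ω) → L²(Ω)²`. -/
noncomputable def grad0 (Ω : Opens Plane) : H10 Ω →ₗ[ℂ] L2Vec Ω :=
  (weakGrad Ω).comp (Submodule.inclusion (H10_le_H1 Ω))

/-- The domain `H¹₀(Ω) × H(div, Ω)` of the grad-div operator, as a subspace of `L²(Ω)³`. -/
noncomputable def gradDivDomain (Ω : Opens Plane) : Submodule ℂ (L2Triple Ω) :=
  ((H10 Ω).prod (Hdiv Ω)).comap (WithLp.linearEquiv 2 ℂ (L2 Ω × L2Vec Ω)).toLinearMap

/-- The first component `u` of `(u, s)` in `H¹₀(Ω) × H(div, Ω)`. -/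
noncomputable def gradDivDomain.fst (Ω : Opens Plane) : gradDivDomain Ω →ₗ[ℂ] H10 Ω where
  toFun x := ⟨x.1.fst, x.2.1⟩
  map_add' _ _ := rfl
  map_smul' _ _ := rfl

/-- The second component `s` of `(u, s)` in `H¹₀(Ω) × H(div, Ω)`. -/
noncomputable def gradDivDomain.snd (Ω : Opens Plane) : gradDivDomain Ω →ₗ[ℂ] Hdiv Ω where
  toFun x := ⟨x.1.snd, x.2.2⟩
  map_add' _ _ := rfl
  map_smul' _ _ := rfl

/-- The grad-div operator `(u, s) ↦ (i div s, i grad u)` in `L²(Ω)³`, with domain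
`H¹₀(Ω) × H(div, Ω)`. -/
noncomputable def gradDiv (Ω : Opens Plane) : L2Triple Ω →ₗ.[ℂ] L2Triple Ω where
  domain := gradDivDomain Ω
  toFun := (WithLp.linearEquiv 2 ℂ (L2 Ω × L2Vec Ω)).symm.toLinearMap.comp
    ((Complex.I • (weakDiv Ω).comp (gradDivDomain.snd Ω)).prod
      (Complex.I • (grad0 Ω).comp (gradDivDomain.fst Ω)))

/-- The subspace of those `u ∈ H¹₀(Ω)` with `grad u ∈ H(div, Ω)`. -/
noncomputable def laplacianDomain (Ω : Opens Plane) : Submodule ℂ (L2 Ω) :=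
  ((Hdiv Ω).comap (grad0 Ω)).map (H10 Ω).subtype

theorem mem_laplacianDomain {Ω : Opens Plane} {u : L2 Ω} :
    u ∈ laplacianDomain Ω ↔ ∃ h : u ∈ H10 Ω, grad0 Ω ⟨u, h⟩ ∈ Hdiv Ω :=
  ⟨fun ⟨v, hv, e⟩ => e ▸ ⟨v.2, hv⟩, fun ⟨h, hu⟩ => ⟨⟨u, h⟩, hu, rfl⟩⟩

/-- The gradient `D(Δ) → H(div, Ω)`. -/
noncomputable def laplacianDomain.grad (Ω : Opens Plane) : laplacianDomain Ω →ₗ[ℂ] Hdiv Ω :=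
  LinearMap.codRestrict (Hdiv Ω)
    ((grad0 Ω).comp (Submodule.inclusion
      (fun _ hu => (mem_laplacianDomain.mp hu).fst : laplacianDomain Ω ≤ H10 Ω)))
    fun u => (mem_laplacianDomain.mp u.2).snd

/-- The Dirichlet Laplacian `-Δ u = -div (grad u)` in `L²(Ω)`, with domain
`{u ∈ H¹₀(Ω) : grad u ∈ H(div, Ω)}`. -/
noncomputable def negDirichletLaplacian (Ω : Opens Plane) : L2 Ω →ₗ.[ℂ] L2 Ω where
  domain := laplacianDomain Ω
  toFun := -(weakDiv Ω).comp (laplacianDomain.grad Ω)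

/-- `x` is an eigenvector (eigenfunction) of the partially defined operator `A` associated to the
eigenvalue `z`: it is a nonzero vector of the domain of `A` with `A x = z x`. -/
def IsEigenvector {E : Type*} [AddCommGroup E] [Module ℂ E] (A : E →ₗ.[ℂ] E) (z : ℂ) (x : E) :
    Prop :=
  x ≠ 0 ∧ ∃ h : x ∈ A.domain, A ⟨x, h⟩ = z • x

/-!
The proof compares the eigenvalue equations `i div s = z u`, `i grad u = z s` of the grad-div
operator with the equation `-div (grad u) = z² u` of the Dirichlet Laplacian.

If `z ≠ 0`, the second equation gives `s = (i / z) grad u`, and substituting it into the first one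
shows that `u` is a Dirichlet eigenfunction for `z²`; this can be reversed
(`IsEigenvector.laplacian_of_gradDiv`, `IsEigenvector.gradDiv_of_laplacian`). Green's formula
`⟪grad u, s⟫ = -⟪u, div s⟫` on `H¹₀(Ω) × H(div, Ω)` (`inner_grad0_eq_neg_inner_weakDiv`), applied to
`s = grad u`, gives `‖grad u‖² = z² ‖u‖²`, so that `z` is real
(`IsEigenvector.exists_real_eq_of_laplacian_sq`) and equals `|z|` or `-|z|`.

If `z = 0`, then `grad u = 0` and `div s = 0`. The boundedness of `Ω` forces `u = 0` by the Poincaré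
inequality (`eq_zero_of_grad0_eq_zero`), which is deduced from the Gagliardo-Nirenberg-Sobolev
inequality `‖φ‖_{L²} ≤ C ‖Dφ‖_{L¹}` in the plane and the embedding `L²(Ω) ⊂ L¹(Ω)`. Both Green's
formula and the Poincaré inequality hold for test functions and are closed conditions on the pair
`(u, grad u)`, hence extend to `H¹₀(Ω)`.
-/

/-! ### Green's formula -/

/-- The complex conjugate of a test function. It links the inner product of `L²`, conjugate-linear
in its first argument, to the bilinear pairing in the definition of weak derivatives. -/
noncomputable def conjTest {Ω : Opens Plane} (φ : 𝓓(Ω, ℂ)) : 𝓓(Ω, ℂ) where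
  toFun x := starRingEnd ℂ (φ x)
  contDiff' := Complex.conjCLE.contDiff.comp φ.contDiff
  hasCompactSupport' := φ.hasCompactSupport.comp_left (map_zero _)
  tsupport_subset' := (closure_mono (Function.support_comp_subset (map_zero (starRingEnd ℂ)) φ)).trans
    φ.tsupport_subset

theorem partialDeriv_conjTest {Ω : Opens Plane} (φ : 𝓓(Ω, ℂ)) (i : Fin 2) (x : Plane) :
    partialDeriv i (conjTest φ) x = starRingEnd ℂ (partialDeriv i φ x) := by
  have h := ((φ.contDiff.differentiable (by simp)) x).hasFDerivAt
  have h' : HasFDerivAt (conjTest φ)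
      ((Complex.conjCLE : ℂ →L[ℝ] ℂ).comp (fderiv ℝ φ x)) x :=
    (Complex.conjCLE : ℂ →L[ℝ] ℂ).hasFDerivAt.comp x h
  simp [partialDeriv, h'.fderiv]

/-- Green's formula for a test function: the definition of the weak divergence, tested against the
conjugate of `φ`. -/
theorem IsWeakDiv.inner_test {Ω : Opens Plane} {s : L2Vec Ω} {d : L2 Ω} (hs : IsWeakDiv Ω s d)
    (φ : 𝓓(Ω, ℂ)) :
    inner ℂ (testGraph Ω φ).2 s = -inner ℂ (testGraph Ω φ).1 d := by
  have h := hs (conjTest φ)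
  have e1 : inner ℂ (testGraph Ω φ).2 s
      = ∫ x in (Ω : Set Plane), ∑ i, s x i * partialDeriv i (conjTest φ) x := by
    rw [L2.inner_def]
    refine integral_congr_ae ?_
    filter_upwards [(memLp_classicalGrad φ).coeFn_toLp] with x hx
    simp only [partialDeriv_conjTest]
    rw [show (testGraph Ω φ).2 x = classicalGrad φ x from hx, PiLp.inner_apply]
    rfl
  have e2 : inner ℂ (testGraph Ω φ).1 d
      = ∫ x in (Ω : Set Plane), d x * conjTest φ x := by
    rw [L2.inner_def]
    refine integral_congr_ae ?_
    filter_upwards [(memLp_test φ).coeFn_toLp] with x hx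
    rw [show (testGraph Ω φ).1 x = φ x from hx]
    rfl
  rw [e1, e2, h]

theorem grad0_mem_closure {Ω : Opens Plane} (u : H10 Ω) :
    ((u : L2 Ω), grad0 Ω u) ∈ closure (Set.range (testGraph Ω)) := by
  obtain ⟨g, hg, hg'⟩ := u.2
  have : grad0 Ω u = g := (isWeakGrad_weakGrad _).unique hg
  rw [this]
  exact hg'

/-- Green's formula: the minimal gradient is minus the adjoint of the maximal divergence. -/
theorem inner_grad0_eq_neg_inner_weakDiv {Ω : Opens Plane} (u : H10 Ω) (s : Hdiv Ω) :
    inner ℂ (grad0 Ω u) (s : L2Vec Ω) = -inner ℂ (u : L2 Ω) (weakDiv Ω s) := by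
  have hc : IsClosed {p : L2 Ω × L2Vec Ω |
      inner ℂ p.2 (s : L2Vec Ω) = -inner ℂ p.1 (weakDiv Ω s)} :=
    isClosed_eq (by fun_prop) (by fun_prop)
  refine closure_minimal ?_ hc (grad0_mem_closure u)
  rintro _ ⟨φ, rfl⟩
  exact (isWeakDiv_weakDiv s).inner_test φ

/-! ### The Poincaré inequality -/

/-- The operator norm of the real derivative of a complex-valued function is compared with the
Hermitian norm of its gradient; the constant is not sharp. -/
theorem norm_fderiv_le_norm_classicalGrad {Ω : Opens Plane} (φ : 𝓓(Ω, ℂ)) (x : Plane) :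
    ‖fderiv ℝ φ x‖ ≤ 2 * ‖classicalGrad φ x‖ := by
  refine ContinuousLinearMap.opNorm_le_bound _ (by positivity) fun v => ?_
  have hv : v = ∑ i, v i • EuclideanSpace.single i (1 : ℝ) := by
    ext j; fin_cases j <;> simp
  have hb : ∀ i, ‖v i • partialDeriv i φ x‖ ≤ ‖v‖ * ‖classicalGrad φ x‖ := fun i => by
    rw [norm_smul]
    exact mul_le_mul (PiLp.norm_apply_le v i) (PiLp.norm_apply_le (classicalGrad φ x) i)
      (norm_nonneg _) (norm_nonneg _)
  calc ‖fderiv ℝ φ x v‖ = ‖∑ i, v i • partialDeriv i φ x‖ := by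
        conv_lhs => rw [hv]
        simp [partialDeriv]
    _ ≤ ∑ i : Fin 2, ‖v‖ * ‖classicalGrad φ x‖ := norm_sum_le_of_le _ fun i _ => hb i
    _ = 2 * ‖classicalGrad φ x‖ * ‖v‖ := by simp; ring

/-- The Poincaré inequality for test functions on a bounded open set. -/
theorem exists_norm_testGraph_fst_le {Ω : Opens Plane}
    (hΩ : Bornology.IsBounded (Ω : Set Plane)) :
    ∃ C : ℝ, ∀ φ : 𝓓(Ω, ℂ), ‖(testGraph Ω φ).1‖ ≤ C * ‖(testGraph Ω φ).2‖ := by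
  let μ := (volume : Measure Plane).restrict (Ω : Set Plane)
  let K := eLpNormLESNormFDerivOneConst (volume : Measure Plane) 2
  have : IsFiniteMeasure μ := ⟨by simpa [μ] using hΩ.measure_lt_top⟩
  -- The Sobolev constant, times 2 from comparing `Dφ` with the gradient, times the norm of the
  -- embedding of `L²(Ω)` in `L¹(Ω)`.
  let B : ENNReal := K * (2 * (μ Set.univ) ^ (1 / (1 : ENNReal).toReal - 1 / (2 : ENNReal).toReal))
  have hB : B ≠ ⊤ := by
    refine ENNReal.mul_ne_top ENNReal.coe_ne_top (ENNReal.mul_ne_top (by simp) ?_)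
    exact ENNReal.rpow_ne_top_of_nonneg (by norm_num) (measure_ne_top _ _)
  refine ⟨B.toReal, fun φ => ?_⟩
  have h1 : eLpNorm φ 2 volume ≤ K * eLpNorm (fderiv ℝ φ) 1 volume :=
    eLpNorm_le_eLpNorm_fderiv_one volume (φ.contDiff.of_le (by simp)) φ.hasCompactSupport
      (by
        rw [finrank_euclideanSpace_fin]
        -- In dimension 2 the Sobolev exponent for `L¹` gradients is 2.
        exact NNReal.holderConjugate_iff.mpr ⟨by norm_num, by norm_num⟩)
  have h2 : eLpNorm (fderiv ℝ φ) 1 μ = eLpNorm (fderiv ℝ φ) 1 volume := by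
    refine eLpNorm_restrict_eq_of_support_subset (ε := Plane →L[ℝ] ℂ) (f := fderiv ℝ φ) ?_
    exact (subset_tsupport _).trans ((tsupport_fderiv_subset ℝ).trans φ.tsupport_subset)
  have h3 : eLpNorm (fderiv ℝ φ) 1 μ ≤ 2 * eLpNorm (classicalGrad φ) 1 μ := by
    have := eLpNorm_le_mul_eLpNorm_of_ae_le_mul (μ := μ)
      (Filter.Eventually.of_forall (norm_fderiv_le_norm_classicalGrad φ)) 1
    simpa using this
  have h4 : eLpNorm (classicalGrad φ) 1 μ ≤ eLpNorm (classicalGrad φ) 2 μ *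
      (μ Set.univ) ^ (1 / (1 : ENNReal).toReal - 1 / (2 : ENNReal).toReal) :=
    eLpNorm_le_eLpNorm_mul_rpow_measure_univ (by norm_num)
      (continuous_classicalGrad φ).aestronglyMeasurable
  have h5 : eLpNorm φ 2 μ ≤ B * eLpNorm (classicalGrad φ) 2 μ :=
    calc eLpNorm φ 2 μ ≤ eLpNorm φ 2 volume := eLpNorm_mono_measure _ Measure.restrict_le_self
      _ ≤ K * (2 * (eLpNorm (classicalGrad φ) 2 μ *
          (μ Set.univ) ^ (1 / (1 : ENNReal).toReal - 1 / (2 : ENNReal).toReal))) := by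
        refine h1.trans ?_
        rw [← h2]
        gcongr
        exact h3.trans (by gcongr)
      _ = B * eLpNorm (classicalGrad φ) 2 μ := by simp only [B]; ring
  change ‖(memLp_test φ).toLp φ‖ ≤ B.toReal * ‖(memLp_classicalGrad φ).toLp (classicalGrad φ)‖
  rw [Lp.norm_toLp, Lp.norm_toLp, ← ENNReal.toReal_mul]
  exact ENNReal.toReal_mono (ENNReal.mul_ne_top hB (memLp_classicalGrad φ).eLpNorm_ne_top) h5

/-- The gradient is injective on `H¹₀(Ω)`, because the Poincaré inequality passes to the closure of
the test functions. -/
theorem eq_zero_of_grad0_eq_zero {Ω : Opens Plane} (hΩ : Bornology.IsBounded (Ω : Set Plane))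
    {u : H10 Ω} (hu : grad0 Ω u = 0) : u = 0 := by
  obtain ⟨C, hC⟩ := exists_norm_testGraph_fst_le hΩ
  have hc : IsClosed {p : L2 Ω × L2Vec Ω | ‖p.1‖ ≤ C * ‖p.2‖} :=
    isClosed_le (by fun_prop) (by fun_prop)
  have hr : Set.range (testGraph Ω) ⊆ {p : L2 Ω × L2Vec Ω | ‖p.1‖ ≤ C * ‖p.2‖} := by
    rintro _ ⟨φ, rfl⟩
    exact hC φ
  have h := closure_minimal hr hc (grad0_mem_closure u)
  change ‖(u : L2 Ω)‖ ≤ C * ‖grad0 Ω u‖ at h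
  rw [hu, norm_zero, mul_zero, norm_le_zero_iff] at h
  exact Subtype.ext h

/-! ### Eigenvectors of the two operators -/

theorem isEigenvector_gradDiv_iff {Ω : Opens Plane} (z : ℂ) (u : H10 Ω) (s : Hdiv Ω) :
    IsEigenvector (gradDiv Ω) z (WithLp.toLp 2 ((u : L2 Ω), (s : L2Vec Ω))) ↔
      ¬(u = 0 ∧ s = 0) ∧ Complex.I • weakDiv Ω s = z • (u : L2 Ω) ∧
        Complex.I • grad0 Ω u = z • (s : L2Vec Ω) := by
  have hm : WithLp.toLp 2 ((u : L2 Ω), (s : L2Vec Ω)) ∈ (gradDiv Ω).domain := ⟨u.2, s.2⟩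
  have hv : gradDiv Ω ⟨_, hm⟩
      = WithLp.toLp 2 (Complex.I • weakDiv Ω s, Complex.I • grad0 Ω u) := rfl
  have h0 : WithLp.toLp 2 ((u : L2 Ω), (s : L2Vec Ω)) = 0 ↔ u = 0 ∧ s = 0 := by
    rw [WithLp.toLp_eq_zero, Prod.mk_eq_zero, Submodule.coe_eq_zero, Submodule.coe_eq_zero]
  unfold IsEigenvector
  rw [exists_prop_of_true hm, hv, ← WithLp.toLp_smul, (WithLp.toLp_injective 2).eq_iff,
    Prod.smul_mk, Prod.mk_inj, Ne, h0]

theorem isEigenvector_negDirichletLaplacian_iff {Ω : Opens Plane} (z : ℂ) (u : H10 Ω) :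
    IsEigenvector (negDirichletLaplacian Ω) z (u : L2 Ω) ↔
      u ≠ 0 ∧ ∃ h : grad0 Ω u ∈ Hdiv Ω, weakDiv Ω ⟨grad0 Ω u, h⟩ = -(z • (u : L2 Ω)) := by
  have hv (h : grad0 Ω u ∈ Hdiv Ω) : negDirichletLaplacian Ω
      ⟨(u : L2 Ω), mem_laplacianDomain.mpr ⟨u.2, h⟩⟩ = -weakDiv Ω ⟨grad0 Ω u, h⟩ := rfl
  refine and_congr (not_congr Submodule.coe_eq_zero) ⟨?_, ?_⟩
  · rintro ⟨h, e⟩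
    obtain ⟨h', hd⟩ := mem_laplacianDomain.mp h
    exact ⟨hd, by rw [← e]; exact (neg_eq_iff_eq_neg.mp (hv hd).symm)⟩
  · rintro ⟨h, e⟩
    exact ⟨mem_laplacianDomain.mpr ⟨u.2, h⟩, by rw [hv h, e, neg_neg]⟩

/-- A Dirichlet Laplacian eigenfunction `u` with eigenvalue `c ^ 2` yields the eigenfunction
`(u, (i / c) grad u)` of the grad-div operator with eigenvalue `c`. -/
theorem IsEigenvector.gradDiv_of_laplacian {Ω : Opens Plane} {c : ℂ} (hc : c ≠ 0) {u : H10 Ω}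
    {s : Hdiv Ω} (hu : IsEigenvector (negDirichletLaplacian Ω) (c ^ 2) (u : L2 Ω))
    (hs : (s : L2Vec Ω) = (Complex.I / c) • grad0 Ω u) :
    IsEigenvector (gradDiv Ω) c (WithLp.toLp 2 ((u : L2 Ω), (s : L2Vec Ω))) := by
  obtain ⟨hu0, hd, e⟩ := (isEigenvector_negDirichletLaplacian_iff _ u).mp hu
  have hs' : s = (Complex.I / c) • (⟨grad0 Ω u, hd⟩ : Hdiv Ω) := Subtype.ext hs
  refine (isEigenvector_gradDiv_iff c u s).mpr ⟨fun h => hu0 h.1, ?_, ?_⟩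
  · rw [hs', map_smul, e, smul_neg, smul_neg, smul_smul, smul_smul, ← neg_smul]
    congr 1
    field_simp
    simp
  · rw [hs, smul_smul]
    congr 1
    field_simp

/-- A nonzero eigenvalue `z` of the grad-div operator has `z ^ 2` an eigenvalue of the Dirichlet
Laplacian, with the first component as eigenfunction. -/
theorem IsEigenvector.laplacian_of_gradDiv {Ω : Opens Plane} {z : ℂ} (hz : z ≠ 0) {u : H10 Ω}
    {s : Hdiv Ω}
    (h : IsEigenvector (gradDiv Ω) z (WithLp.toLp 2 ((u : L2 Ω), (s : L2Vec Ω)))) :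
    IsEigenvector (negDirichletLaplacian Ω) (z ^ 2) (u : L2 Ω) ∧
      (s : L2Vec Ω) = (Complex.I / z) • grad0 Ω u := by
  obtain ⟨h0, h1, h2⟩ := (isEigenvector_gradDiv_iff z u s).mp h
  have hs : (s : L2Vec Ω) = (Complex.I / z) • grad0 Ω u := by
    rw [div_eq_inv_mul, mul_smul, h2, inv_smul_smul₀ hz]
  have hg : grad0 Ω u = ((-Complex.I * z) • s : Hdiv Ω) := by
    rw [Submodule.coe_smul, mul_smul, ← h2, smul_smul]
    simp
  have hd : weakDiv Ω s = (-Complex.I * z) • (u : L2 Ω) := by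
    rw [mul_smul, ← h1, smul_smul]
    simp
  refine ⟨(isEigenvector_negDirichletLaplacian_iff _ u).mpr ⟨fun hu => h0 ⟨hu, ?_⟩,
    hg ▸ Subtype.property _, ?_⟩, hs⟩
  · exact Subtype.ext (by rw [hs, hu, map_zero, smul_zero]; rfl)
  · rw [show (⟨grad0 Ω u, _⟩ : Hdiv Ω) = (-Complex.I * z) • s from Subtype.ext hg, map_smul, hd,
      smul_smul, ← neg_smul]
    congr 1
    ring_nf
    simp

/-- The Dirichlet Laplacian is nonnegative, so a square root of one of its eigenvalues is real. -/
theorem IsEigenvector.exists_real_eq_of_laplacian_sq {Ω : Opens Plane} {z : ℂ} {u : H10 Ω}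
    (hu : IsEigenvector (negDirichletLaplacian Ω) (z ^ 2) (u : L2 Ω)) : ∃ ω : ℝ, z = ω := by
  obtain ⟨hu0, hd, e⟩ := (isEigenvector_negDirichletLaplacian_iff _ u).mp hu
  have hg := inner_grad0_eq_neg_inner_weakDiv u ⟨grad0 Ω u, hd⟩
  rw [e, inner_neg_right, neg_neg, inner_smul_right, inner_self_eq_norm_sq_to_K,
    inner_self_eq_norm_sq_to_K] at hg
  have hn : ‖(u : L2 Ω)‖ ≠ 0 := by simpa using hu0
  have hn' : (‖(u : L2 Ω)‖ : ℂ) ≠ 0 := by exact_mod_cast hn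
  have hz : z ^ 2 = ((‖grad0 Ω u‖ / ‖(u : L2 Ω)‖ : ℝ) : ℂ) ^ 2 := by
    push_cast
    rw [div_pow, eq_div_iff (pow_ne_zero 2 hn')]
    exact hg.symm
  rcases sq_eq_sq_iff_eq_or_eq_neg.mp hz with h | h
  · exact ⟨_, h⟩
  · exact ⟨_, h.trans (Complex.ofReal_neg _).symm⟩

theorem lemma4p1 (Ω : Opens Plane) (hΩ : Bornology.IsBounded (Ω : Set Plane))
    (u : H10 Ω) (s : Hdiv Ω) :
    ((∃ z : ℂ, IsEigenvector (gradDiv Ω) z (WithLp.toLp 2 ((u : L2 Ω), (s : L2Vec Ω)))) ↔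
      ((∃ ω : ℝ, ω ≠ 0 ∧ IsEigenvector (negDirichletLaplacian Ω) ((ω : ℂ) ^ 2) (u : L2 Ω) ∧
          ((s : L2Vec Ω) = (Complex.I / ((|ω| : ℝ) : ℂ)) • grad0 Ω u ∨
            (s : L2Vec Ω) = (-Complex.I / ((|ω| : ℝ) : ℂ)) • grad0 Ω u)) ∨
        (u = 0 ∧ s ≠ 0 ∧ weakDiv Ω s = 0))) ∧
    (∀ ω : ℝ, ω ≠ 0 → IsEigenvector (negDirichletLaplacian Ω) ((ω : ℂ) ^ 2) (u : L2 Ω) →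
      ((s : L2Vec Ω) = (Complex.I / ((|ω| : ℝ) : ℂ)) • grad0 Ω u →
        IsEigenvector (gradDiv Ω) ((|ω| : ℝ) : ℂ)
          (WithLp.toLp 2 ((u : L2 Ω), (s : L2Vec Ω)))) ∧
      ((s : L2Vec Ω) = (-Complex.I / ((|ω| : ℝ) : ℂ)) • grad0 Ω u →
        IsEigenvector (gradDiv Ω) (-((|ω| : ℝ) : ℂ))
          (WithLp.toLp 2 ((u : L2 Ω), (s : L2Vec Ω))))) ∧
    (u = 0 → s ≠ 0 → weakDiv Ω s = 0 →
      IsEigenvector (gradDiv Ω) 0 (WithLp.toLp 2 ((u : L2 Ω), (s : L2Vec Ω)))) := by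
  have plus : ∀ ω : ℝ, ω ≠ 0 →
      IsEigenvector (negDirichletLaplacian Ω) ((ω : ℂ) ^ 2) (u : L2 Ω) →
      (s : L2Vec Ω) = (Complex.I / ((|ω| : ℝ) : ℂ)) • grad0 Ω u →
      IsEigenvector (gradDiv Ω) ((|ω| : ℝ) : ℂ)
        (WithLp.toLp 2 ((u : L2 Ω), (s : L2Vec Ω))) := by
    intro ω hω hu hs
    refine .gradDiv_of_laplacian (by simpa using hω) ?_ hs
    rwa [← Complex.ofReal_pow, sq_abs, Complex.ofReal_pow]
  have minus : ∀ ω : ℝ, ω ≠ 0 →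
      IsEigenvector (negDirichletLaplacian Ω) ((ω : ℂ) ^ 2) (u : L2 Ω) →
      (s : L2Vec Ω) = (-Complex.I / ((|ω| : ℝ) : ℂ)) • grad0 Ω u →
      IsEigenvector (gradDiv Ω) (-((|ω| : ℝ) : ℂ))
        (WithLp.toLp 2 ((u : L2 Ω), (s : L2Vec Ω))) := by
    intro ω hω hu hs
    refine .gradDiv_of_laplacian (by simpa using hω) ?_ (by rwa [div_neg, ← neg_div])
    rwa [neg_sq, ← Complex.ofReal_pow, sq_abs, Complex.ofReal_pow]
  have zero : u = 0 → s ≠ 0 → weakDiv Ω s = 0 →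
      IsEigenvector (gradDiv Ω) 0 (WithLp.toLp 2 ((u : L2 Ω), (s : L2Vec Ω))) := by
    intro hu hs hd
    exact (isEigenvector_gradDiv_iff 0 u s).mpr
      ⟨fun h => hs h.2, by simp [hd], by simp [hu]⟩
  refine ⟨⟨?_, ?_⟩, fun ω hω hu => ⟨plus ω hω hu, minus ω hω hu⟩, zero⟩
  · rintro ⟨z, h⟩
    by_cases hz : z = 0
    · obtain ⟨h0, h1, h2⟩ := (isEigenvector_gradDiv_iff z u s).mp h
      rw [hz, zero_smul, smul_eq_zero_iff_right Complex.I_ne_zero] at h1 h2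
      have hu := eq_zero_of_grad0_eq_zero hΩ h2
      exact .inr ⟨hu, fun hs => h0 ⟨hu, hs⟩, h1⟩
    · obtain ⟨hu, hs⟩ := h.laplacian_of_gradDiv hz
      obtain ⟨ω, rfl⟩ := hu.exists_real_eq_of_laplacian_sq
      refine .inl ⟨ω, by simpa using hz, hu, ?_⟩
      rcases abs_choice ω with hω | hω
      · exact .inl (by rw [hω, hs])
      · exact .inr (by rw [hω, hs, Complex.ofReal_neg, neg_div_neg_eq])
  · rintro (⟨ω, hω, hu, hs | hs⟩ | ⟨hu, hs, hd⟩)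
    · exact ⟨_, plus ω hω hu hs⟩
    · exact ⟨_, minus ω hω hu hs⟩
    · exact ⟨0, zero hu hs hd⟩
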